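/- Let $\mathbf{k}$ be a field and let $V$ be a $\mathbf{k}$-vector space with basis $X$. A dendriform dialgebra is a vector space $D$ with bilinear operations $\prec,\succ$ such that $(x\prec y)\prec z=x\prec(y\prec z+y\succ z)$, $(x\succ y)\prec z=x\succ(y\prec z)$ and $(x\prec y+x\succ y)\succ z=x\succ(y\succ z)$. A nonunitary Rota-Baxter algebra of weight zero is a nonunitary associative algebra $A$ with a linear operator $R$ such that $R(x)R(y)=R(R(x)y+xR(y))$. Let $\mathrm{Dend}(V)$ be the vector space with basis the planar binary trees $T\neq |$ whose vertices are decorated by elements of $X$, where $|$ is the tree with one leaf. Write $T=T^\ell\vee_x T^r$ for the grafting of $T^\ell$ and $T^r$ over $x\in X$. For $T=T^\ell\vee_x T^r$ and $U=U^\ell\vee_y U^r$ put recursively $$T\prec U=T^\ell\vee_x(T^r\star U),\qquad T\succ U=(T\star U^\ell)\vee_y U^r,$$ where $\star=\prec+\succ$ and $|\star T=T\star|=T$. Let $i_V:V\to\mathrm{Dend}(V)$ be the linear map with $x\mapsto |\vee_x|$ for $x\in X$. Let $\mathfrak{X}_\infty$ be the set of Rota-Baxter words on $X$: the nonempty words over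 $X\cup\{\lfloor,\rfloor\}$ whose factors are alternately elements of $X$ and bracketed words $\lfloor w\rfloor$ with $w\in\mathfrak{X}_\infty$. Let $\mathrm{RB}(V)$ be the vector space with basis $\mathfrak{X}_\infty$, with the linear operator $R(w)=\lfloor w\rfloor$ and the bilinear product $\diamond$ given as follows for words $w=w_1\cdots w_b$, $w'=w'_1\cdots w'_{b'}$ with their factors: $w\diamond w'=w_1\cdots w_{b-1}(w_b\diamond w'_1)w'_2\cdots w'_{b'}$, where $w_b\diamond w'_1$ is the concatenation if exactly one of $w_b,w'_1$ is in $X$, is $0$ if both are in $X$, and $\lfloor c\rfloor\diamond\lfloor c'\rfloor=\lfloor\lfloor c\rfloor\diamond c'\rfloor+\lfloor c\diamond\lfloor c'\rfloor\rfloor$ otherwise. Let $j_V:V\to\mathrm{RB}(V)$ be the linear map with $x\mapsto x$ for $x\in X$, and put $a\prec_R b=a\diamond R(b)$ and $a\succ_R b=R(a)\diamond b$. Let $\phi:\mathrm{Dend}(V)\to\mathrm{RB}(V)$ be the linear map given on trees recursively by $\phi(T^\ell\vee_x T^r)=\lfloor\phi(T^\ell)\rfloor\,x\,\lfloor\phi(T^r)\rfloor$,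 where the factor $\lfloor\phi(T^\ell)\rfloor$ (resp. $\lfloor\phi(T^r)\rfloor$) is left out if $T^\ell=|$ (resp. $T^r=|$). A dendriform diword is a word $u\in\mathfrak{X}_\infty$ that is not of the form $\lfloor w\rfloor$ with $w\in\mathfrak X_\infty$ and has no subword of the form $\lfloor\lfloor w\rfloor\rfloor$ or $x\lfloor w\rfloor y$ with $x,y\in X$ and $w\in\mathfrak{X}_\infty$. Then: 1. $(\mathrm{Dend}(V),\prec,\succ)$ with $i_V$ is the free dendriform dialgebra over the vector space $V$. 2. $(\mathrm{RB}(V),\diamond,R)$ with $j_V$ is the free nonunitary Rota-Baxter algebra of weight zero over the algebra $V$ with the zero product. 3. $(\mathrm{RB}(V),\prec_R,\succ_R)$ is a dendriform dialgebra, and $\phi$ is a homomorphism of dendriform dialgebras. 4. $\phi$ is the unique homomorphism of dendriform dialgebras with $\phi\circ i_V=j_V$. 5. The image of $\phi$ is the linear span of the dendriform diwords. 6. $\phi$ is injective. In particular, the free dendriform dialgebra over $V$ is a sub dendriform dialgebra of the free Rota-Baxter algebra of weight zero over $V$. -/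

import Mathlib

/-! ### Rota-Baxter algebras and dendriform dialgebras -/

/-- `A`, with the bilinear product `mul` and the linear operator `R`, is a nonunitary (associative)
Rota-Baxter algebra of weight `lam`. -/
structure IsRotaBaxterAlgebra {k A : Type*} [CommRing k] [AddCommGroup A] [Module k A]
    (lam : k) (mul : A →ₗ[k] A →ₗ[k] A) (R : A →ₗ[k] A) : Prop where
  assoc : ∀ x y z, mul (mul x y) z = mul x (mul y z)
  rota_baxter : ∀ x y, mul (R x) (R y) = R (mul (R x) y + mul x (R y) + lam • mul x y)

/-- Homomorphisms of nonunitary algebras. -/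
def IsAlgebraHom {k A B : Type*} [CommRing k] [AddCommGroup A] [Module k A]
    [AddCommGroup B] [Module k B] (mulA : A →ₗ[k] A →ₗ[k] A) (mulB : B →ₗ[k] B →ₗ[k] B)
    (f : A →ₗ[k] B) : Prop :=
  ∀ x y, f (mulA x y) = mulB (f x) (f y)

/-- `(F, mul, R, j)` is a free nonunitary Rota-Baxter algebra of weight `lam` over the nonunitary
algebra `(B, mulB)`; the test objects range over the universe `w`. -/
structure IsFreeRotaBaxterAlgebra.{w, u, v, t} {k : Type u} {B : Type v} {F : Type t} [CommRing k]
    [AddCommGroup B] [Module k B] [AddCommGroup F] [Module k F]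
    (lam : k) (mulB : B →ₗ[k] B →ₗ[k] B)
    (mul : F →ₗ[k] F →ₗ[k] F) (R : F →ₗ[k] F) (j : B →ₗ[k] F) : Prop where
  isRotaBaxterAlgebra : IsRotaBaxterAlgebra lam mul R
  isAlgebraHom : IsAlgebraHom mulB mul j
  existsUnique_lift : ∀ (A : Type w) [AddCommGroup A] [Module k A]
    (mulA : A →ₗ[k] A →ₗ[k] A) (RA : A →ₗ[k] A), IsRotaBaxterAlgebra lam mulA RA →
    ∀ f : B →ₗ[k] A, IsAlgebraHom mulB mulA f →
      ∃! g : F →ₗ[k] A, (IsAlgebraHom mul mulA g ∧ ∀ x, g (R x) = RA (g x)) ∧ g ∘ₗ j = f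

/-- `D`, with the bilinear operations `prec` (`≺`) and `succ` (`≻`), is a dendriform dialgebra. -/
structure IsDendriform {k D : Type*} [CommRing k] [AddCommGroup D] [Module k D]
    (prec succ : D →ₗ[k] D →ₗ[k] D) : Prop where
  prec_prec : ∀ x y z, prec (prec x y) z = prec x (prec y z + succ y z)
  succ_prec : ∀ x y z, prec (succ x y) z = succ x (prec y z)
  succ_succ : ∀ x y z, succ (prec x y + succ x y) z = succ x (succ y z)

/-- Homomorphisms of dendriform dialgebras. -/
structure IsDendriformHom {k D E : Type*} [CommRing k] [AddCommGroup D] [Module k D]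
    [AddCommGroup E] [Module k E] (precD succD : D →ₗ[k] D →ₗ[k] D)
    (precE succE : E →ₗ[k] E →ₗ[k] E) (f : D →ₗ[k] E) : Prop where
  map_prec : ∀ x y, f (precD x y) = precE (f x) (f y)
  map_succ : ∀ x y, f (succD x y) = succE (f x) (f y)

/-- `(F, prec, succ, i)` is a free dendriform dialgebra over the vector space `V`; the test
objects range over the universe `w`. -/
structure IsFreeDendriform.{w, u, v, t} {k : Type u} {V : Type v} {F : Type t} [CommRing k]
    [AddCommGroup V] [Module k V] [AddCommGroup F] [Module k F]
    (prec succ : F →ₗ[k] F →ₗ[k] F) (i : V →ₗ[k] F) : Prop where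
  isDendriform : IsDendriform prec succ
  existsUnique_lift : ∀ (D : Type w) [AddCommGroup D] [Module k D]
    (precD succD : D →ₗ[k] D →ₗ[k] D), IsDendriform precD succD →
    ∀ f : V →ₗ[k] D,
      ∃! g : F →ₗ[k] D, IsDendriformHom prec succ precD succD g ∧ g ∘ₗ i = f

/-- The operation `x ≺_R y = x R(y)`. -/
def rbPrec {k A : Type*} [CommRing k] [AddCommGroup A] [Module k A]
    (mul : A →ₗ[k] A →ₗ[k] A) (R : A →ₗ[k] A) : A →ₗ[k] A →ₗ[k] A :=
  mul.compl₂ R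

/-- The operation `x ≻_R y = R(x) y`. -/
def rbSucc {k A : Type*} [CommRing k] [AddCommGroup A] [Module k A]
    (mul : A →ₗ[k] A →ₗ[k] A) (R : A →ₗ[k] A) : A →ₗ[k] A →ₗ[k] A :=
  mul ∘ₗ R

/-- The bilinear extension of an operation given on basis elements. -/
noncomputable def bilinearExtension (k : Type*) [CommRing k] {S : Type*}
    (op : S → S → (S →₀ k)) : (S →₀ k) →ₗ[k] (S →₀ k) →ₗ[k] (S →₀ k) :=
  Finsupp.linearCombination k fun s => Finsupp.linearCombination k fun t => op s t

/-! ### Loday's dendriform dialgebra of decorated planar binary trees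

`BinaryTree X` is the type of planar binary trees with vertices decorated by `X`; `BinaryTree.nil`
is the tree `|` with one leaf, and `BinaryTree.node x l r` is the grafting `l ∨_x r`. -/

/-- Decorated planar binary trees other than `|`. -/
abbrev NTree (X : Type*) : Type _ := {T : BinaryTree X // T ≠ BinaryTree.nil}

/-- The grafting `l ∨_x r`. -/
def NTree.graft {X : Type*} (x : X) (l r : BinaryTree X) : NTree X :=
  ⟨BinaryTree.node x l r, by simp⟩

/-- The operation `⋆` on trees, with `| ⋆ T = T ⋆ | = T` and
`T ⋆ U = T^ℓ ∨_x (T^r ⋆ U) + (T ⋆ U^ℓ) ∨_y U^r`, the sum of `T ≺ U` and `T ≻ U`,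
for `T = T^ℓ ∨_x T^r` and `U = U^ℓ ∨_y U^r`. -/
noncomputable def treeStar (k : Type*) [CommRing k] {X : Type*} :
    BinaryTree X → BinaryTree X → (BinaryTree X →₀ k)
  | .nil, U => Finsupp.single U 1
  | .node x l r, .nil => Finsupp.single (.node x l r) 1
  | .node x l r, .node y l' r' =>
      (treeStar k r (.node y l' r')).mapDomain (fun S => .node x l S) +
      (treeStar k (.node x l r) l').mapDomain (fun S => .node y S r')
termination_by T U => sizeOf T + sizeOf U

/-- `T ≺ U = T^ℓ ∨_x (T^r ⋆ U)` for `T = T^ℓ ∨_x T^r`. -/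
noncomputable def treePrec (k : Type*) [CommRing k] {X : Type*} :
    NTree X → NTree X → (NTree X →₀ k)
  | ⟨.nil, h⟩, _ => absurd rfl h
  | ⟨.node x l r, _⟩, U => (treeStar k r U.1).mapDomain (fun S => NTree.graft x l S)

/-- `T ≻ U = (T ⋆ U^ℓ) ∨_y U^r` for `U = U^ℓ ∨_y U^r`. -/
noncomputable def treeSucc (k : Type*) [CommRing k] {X : Type*} :
    NTree X → NTree X → (NTree X →₀ k)
  | _, ⟨.nil, h⟩ => absurd rfl h
  | T, ⟨.node y l r, _⟩ => (treeStar k T.1 l).mapDomain (fun S => NTree.graft y S r)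

/-- On trees other than `|`, the operation `⋆` is `≺ + ≻`. -/
theorem treeStar_eq (k : Type*) [CommRing k] {X : Type*} (T U : NTree X) :
    treeStar k T.1 U.1 = (treePrec k T U + treeSucc k T U).mapDomain Subtype.val := by
  obtain ⟨T, hT⟩ := T
  obtain ⟨U, hU⟩ := U
  cases T with
  | nil => exact absurd rfl hT
  | node x l r =>
    cases U with
    | nil => exact absurd rfl hU
    | node y l' r' =>
      rw [Finsupp.mapDomain_add, treePrec, treeSucc, ← Finsupp.mapDomain_comp,
        ← Finsupp.mapDomain_comp, treeStar]
      rfl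

/-- The underlying vector space of `Dend(V)`, where `X` indexes a basis of `V`. -/
abbrev Dend (k X : Type*) [CommRing k] : Type _ := NTree X →₀ k

namespace Dend

/-- The operation `≺` of `Dend(V)`. -/
noncomputable def prec (k X : Type*) [CommRing k] :
    Dend k X →ₗ[k] Dend k X →ₗ[k] Dend k X :=
  bilinearExtension k (treePrec k)

/-- The operation `≻` of `Dend(V)`. -/
noncomputable def succ (k X : Type*) [CommRing k] :
    Dend k X →ₗ[k] Dend k X →ₗ[k] Dend k X :=
  bilinearExtension k (treeSucc k)

/-- The natural map `V → Dend(V)`, sending the basis vector `x` to `| ∨_x |`. -/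
noncomputable def incl {k V X : Type*} [CommRing k] [AddCommGroup V] [Module k V]
    (b : Module.Basis X k V) : V →ₗ[k] Dend k X :=
  b.constr k fun x => Finsupp.single (NTree.graft x .nil .nil) 1

end Dend

/-! ### The free Rota-Baxter algebra of weight zero over `V` with the zero product -/

/-- Rota-Baxter bracketed words on the alphabet `X`: the nonempty words whose factors are
alternately a letter of `X` and a bracketed Rota-Baxter word `⌊w⌋`. The index is the head of the
word: `false` if the first factor is a letter, `true` if it is a bracketed word. -/
inductive RBWord (X : Type*) : Bool → Type _
  /-- the word `x` -/
  | letter (x : X) : RBWord X false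
  /-- the word `x u`, where `u` begins with a bracketed word -/
  | letterCons (x : X) (u : RBWord X true) : RBWord X false
  /-- the word `⌊w⌋` -/
  | bracket {h : Bool} (w : RBWord X h) : RBWord X true
  /-- the word `⌊w⌋ u`, where `u` begins with a letter -/
  | bracketCons {h : Bool} (w : RBWord X h) (u : RBWord X false) : RBWord X true

/-- The set `𝔛_∞` of all Rota-Baxter words. -/
abbrev RBWords (X : Type*) : Type _ := Σ h : Bool, RBWord X h

/-- The alphabet `X ∪ {⌊, ⌋}`. -/
inductive BracketLetter (X : Type*) : Type _
  | var (x : X)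
  | lb
  | rb

namespace RBWord

/-- A Rota-Baxter word spelled out in the alphabet `X ∪ {⌊, ⌋}`. -/
def spell {X : Type*} : {h : Bool} → RBWord X h → List (BracketLetter X)
  | _, letter x => [.var x]
  | _, letterCons x u => .var x :: spell u
  | _, bracket w => .lb :: (spell w ++ [.rb])
  | _, bracketCons w u => .lb :: (spell w ++ .rb :: spell u)

/-- The product `w ⋄ w'` of two Rota-Baxter words, in weight zero and with the zero product on the
span of `X`. If the last factor `a` of `w` and the first factor `a'` of `w'` are of different
kinds, it is the concatenation. Otherwise these two factors are replaced by `a ⋄ a'`, which is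
`0` if both are letters, and `⌊⌊c⌋ ⋄ c'⌋ + ⌊c ⋄ ⌊c'⌋⌋` if `a = ⌊c⌋` and `a' = ⌊c'⌋`.
The product has the same head as `w`. -/
noncomputable def mul (k : Type*) [CommRing k] {X : Type*} :
    {h h' : Bool} → RBWord X h → RBWord X h' → (RBWord X h →₀ k)
  | _, _, letterCons x u, w' => (mul k u w').mapDomain (fun c => letterCons x c)
  | _, _, bracketCons w u, w' => (mul k u w').mapDomain (fun c => bracketCons w c)
  | _, _, letter _, letter _ => 0
  | _, _, letter _, letterCons _ _ => 0
  | _, _, letter x, bracket c' => Finsupp.single (letterCons x (bracket c')) 1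
  | _, _, letter x, bracketCons c' v => Finsupp.single (letterCons x (bracketCons c' v)) 1
  | _, _, bracket c, letter x => Finsupp.single (bracketCons c (letter x)) 1
  | _, _, bracket c, letterCons x v => Finsupp.single (bracketCons c (letterCons x v)) 1
  | _, _, bracket c, bracket c' =>
      (mul k (bracket c) c').mapDomain (fun d => bracket d) +
      (mul k c (bracket c')).mapDomain (fun d => bracket d)
  | _, _, bracket c, bracketCons c' v =>
      (mul k (bracket c) c').mapDomain (fun d => bracketCons d v) +
      (mul k c (bracket c')).mapDomain (fun d => bracketCons d v)
termination_by _ _ w w' => sizeOf w + sizeOf w'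

end RBWord

/-- The underlying vector space of the free Rota-Baxter algebra over `V`, where `X` indexes a
basis of `V`. -/
abbrev FreeRB (k X : Type*) [CommRing k] : Type _ := RBWords X →₀ k

namespace FreeRB

/-- The product `⋄`. -/
noncomputable def mul (k X : Type*) [CommRing k] :
    FreeRB k X →ₗ[k] FreeRB k X →ₗ[k] FreeRB k X :=
  bilinearExtension k fun w w' => (RBWord.mul k w.2 w'.2).mapDomain (fun c => ⟨w.1, c⟩)

/-- The Rota-Baxter operator `w ↦ ⌊w⌋`. -/
noncomputable def op (k X : Type*) [CommRing k] : FreeRB k X →ₗ[k] FreeRB k X :=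
  Finsupp.lmapDomain k k fun w => ⟨true, .bracket w.2⟩

/-- The natural map `j_V : V → FreeRB`, sending the basis vector `x` to the word `x`. -/
noncomputable def incl {k V X : Type*} [CommRing k] [AddCommGroup V] [Module k V]
    (b : Module.Basis X k V) : V →ₗ[k] FreeRB k X :=
  b.constr k fun x => Finsupp.single ⟨false, .letter x⟩ 1

/-- The operation `w ≺_R w' = w ⋄ ⌊w'⌋`. -/
noncomputable def prec (k X : Type*) [CommRing k] :
    FreeRB k X →ₗ[k] FreeRB k X →ₗ[k] FreeRB k X :=
  rbPrec (mul k X) (op k X)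

/-- The operation `w ≻_R w' = ⌊w⌋ ⋄ w'`. -/
noncomputable def succ (k X : Type*) [CommRing k] :
    FreeRB k X →ₗ[k] FreeRB k X →ₗ[k] FreeRB k X :=
  rbSucc (mul k X) (op k X)

end FreeRB

/-! ### The map `φ` and dendriform diwords -/

/-- The Rota-Baxter word `φ(T)` of a tree `T ≠ |`: for `T = T^ℓ ∨_x T^r` it is
`⌊φ(T^ℓ)⌋ x ⌊φ(T^r)⌋`, where the bracket of a subtree equal to `|` is left out. -/
def treeWord {X : Type*} : (T : BinaryTree X) → T ≠ BinaryTree.nil → RBWords X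
  | .nil, h => absurd rfl h
  | .node x .nil .nil, _ => ⟨false, .letter x⟩
  | .node x .nil (.node z r₁ r₂), _ =>
      ⟨false, .letterCons x (.bracket (treeWord (.node z r₁ r₂) (by simp)).2)⟩
  | .node x (.node y l₁ l₂) .nil, _ =>
      ⟨true, .bracketCons (treeWord (.node y l₁ l₂) (by simp)).2 (.letter x)⟩
  | .node x (.node y l₁ l₂) (.node z r₁ r₂), _ =>
      ⟨true, .bracketCons (treeWord (.node y l₁ l₂) (by simp)).2
        (.letterCons x (.bracket (treeWord (.node z r₁ r₂) (by simp)).2))⟩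

/-- The linear map `φ : Dend(V) → FreeRB`. -/
noncomputable def dendToRB (k X : Type*) [CommRing k] : Dend k X →ₗ[k] FreeRB k X :=
  Finsupp.lmapDomain k k fun T => treeWord T.1 T.2

/-- Dendriform diwords: the Rota-Baxter words that are not of the form `⌊w⌋` and contain, as words
in the alphabet `X ∪ {⌊, ⌋}`, no subword `⌊⌊w⌋⌋` and no subword `x ⌊w⌋ y` with `x, y ∈ X` and a
Rota-Baxter word `w`. -/
structure IsDiword {X : Type*} (u : RBWords X) : Prop where
  not_bracket : ∀ w : RBWords X, u ≠ ⟨true, .bracket w.2⟩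
  not_bracket_bracket : ∀ w : RBWords X,
    ¬ ([.lb, .lb] ++ w.2.spell ++ [.rb, .rb]) <:+: u.2.spell
  not_letter_bracket_letter : ∀ (x y : X) (w : RBWords X),
    ¬ ([.var x, .lb] ++ w.2.spell ++ [.rb, .var y]) <:+: u.2.spell

/-- The span `DW(V)` of the dendriform diwords. -/
noncomputable def diwordSpan (k X : Type*) [CommRing k] : Submodule k (FreeRB k X) :=
  Submodule.span k ((fun u => Finsupp.single u 1) '' {u : RBWords X | IsDiword u})

universe w₁ w₂ u v t

/-!
In a dendriform dialgebra `D` with a formal unit adjoined, a tree `T^ℓ ∨_x T^r` evaluates to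
`T^ℓ ≻ f(x) ≺ T^r`. The dendriform axioms, extended to the unit, say that this evaluation turns the
recursion defining `⋆` into the product of `D`, so it is a homomorphism, and clearly the only one
with the given values on `V`.

In the Rota-Baxter words, the product with a letter or with a bracketed word `⌊a⌋` on the left of a
word beginning with a factor of the other kind is concatenation, hence associates with everything.
This reduces the associativity of `⋄` to three bracketed factors, where it follows from the
Rota-Baxter identity by induction, and the evaluation of words in a Rota-Baxter algebra is
multiplicative by the same reduction.

The map `φ` is the evaluation of trees in the Rota-Baxter words. A word `φ(T)` determines `T`, so
`φ` is injective, and the dendriform axioms for trees are inherited from the Rota-Baxter words. The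
words `φ(T)` are those in which each bracket level contains exactly one letter: a subword `⌊⌊w⌋⌋`
creates a level with none, and a subword `x⌊w⌋y` a level with two.
-/

section LinearExtension

variable {k S T M N : Type*}

theorem linearCombination_mapDomain_eq_map [Semiring k] [AddCommMonoid M] [Module k M]
    [AddCommMonoid N] [Module k N] {g : S → T} {v : S → M} {v' : T → N} (L : M →ₗ[k] N)
    (h : ∀ s, v' (g s) = L (v s)) (p : S →₀ k) :
    Finsupp.linearCombination k v' (p.mapDomain g) = L (Finsupp.linearCombination k v p) := by
  rw [Finsupp.linearCombination_mapDomain, Finsupp.apply_linearCombination]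
  exact congrArg (Finsupp.linearCombination k · p) (funext h)

theorem bilinearExtension_single [CommRing k] (op : S → S → (S →₀ k)) (s t : S) :
    bilinearExtension k op (Finsupp.single s 1) (Finsupp.single t 1) = op s t := by
  simp [bilinearExtension]

theorem map_bilinearExtension [CommRing k] [AddCommGroup M] [Module k M]
    {op : S → S → (S →₀ k)} {mul : M →ₗ[k] M →ₗ[k] M} {g : (S →₀ k) →ₗ[k] M}
    (h : ∀ s t, g (op s t) = mul (g (Finsupp.single s 1)) (g (Finsupp.single t 1)))
    (x y : S →₀ k) : g (bilinearExtension k op x y) = mul (g x) (g y) := by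
  have h_maps : (bilinearExtension k op).compr₂ g = mul.compl₁₂ g g := by
    ext s t
    simpa [bilinearExtension] using h s t
  exact LinearMap.congr_fun₂ h_maps x y

theorem mul_assoc_on_span [CommRing k] [AddCommGroup M] [Module k M] {mul : M →ₗ[k] M →ₗ[k] M}
    {s t u : Set M}
    (h : ∀ a ∈ s, ∀ b ∈ t, ∀ c ∈ u, mul (mul a b) c = mul a (mul b c)) {a b c : M}
    (ha : a ∈ Submodule.span k s) (hb : b ∈ Submodule.span k t) (hc : c ∈ Submodule.span k u) :
    mul (mul a b) c = mul a (mul b c) := by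
  induction hc using Submodule.span_induction with
  | mem c hc =>
    induction ha, hb using Submodule.span_induction₂ with
    | mem_mem a b ha hb => exact h a ha b hb c hc
    | zero_left | zero_right | add_left | add_right | smul_left | smul_right => simp [*]
  | zero | add | smul => simp [*]

theorem map_mul_on_span [CommRing k] [AddCommGroup M] [Module k M] [AddCommGroup N] [Module k N]
    {mul : M →ₗ[k] M →ₗ[k] M} {mulN : N →ₗ[k] N →ₗ[k] N} {g : M →ₗ[k] N} {s t : Set M}
    (h : ∀ a ∈ s, ∀ b ∈ t, g (mul a b) = mulN (g a) (g b)) {a b : M}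
    (ha : a ∈ Submodule.span k s) (hb : b ∈ Submodule.span k t) :
    g (mul a b) = mulN (g a) (g b) := by
  induction ha, hb using Submodule.span_induction₂ with
  | mem_mem a b ha hb => exact h a ha b hb
  | zero_left | zero_right | add_left | add_right | smul_left | smul_right => simp [*]

end LinearExtension

/-! ### The augmentation of a dendriform dialgebra -/

section Augmentation

variable {k D : Type*} [CommRing k] [AddCommGroup D] [Module k D]

/-- The operation `y ≺ p` for `y` in `D` and `p` in the augmentation `k × D`, whose unit `(1, 0)`
acts as the identity. -/
def augPrec (prec : D →ₗ[k] D →ₗ[k] D) : D →ₗ[k] k × D →ₗ[k] D :=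
  ((LinearMap.lsmul k D).coprod prec.flip).flip

/-- The operation `p ≻ y` for `p` in the augmentation `k × D` and `y` in `D`. -/
def augSucc (succ : D →ₗ[k] D →ₗ[k] D) : k × D →ₗ[k] D →ₗ[k] D :=
  (LinearMap.lsmul k D).coprod succ

/-- The extension of `⋆ = ≺ + ≻` to the augmentation `k × D`, with unit `(1, 0)`. -/
def augStar (prec succ : D →ₗ[k] D →ₗ[k] D) (p q : k × D) : k × D :=
  (p.1 * q.1, p.1 • q.2 + q.1 • p.2 + (prec p.2 q.2 + succ p.2 q.2))

variable {prec succ : D →ₗ[k] D →ₗ[k] D}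

theorem augPrec_apply (y : D) (p : k × D) : augPrec prec y p = p.1 • y + prec y p.2 := by
  simp [augPrec]

theorem augSucc_apply (p : k × D) (y : D) : augSucc succ p y = p.1 • y + succ p.2 y := by
  simp [augSucc]

namespace IsDendriform

variable (hD : IsDendriform prec succ)
include hD

theorem augPrec_augStar (y : D) (p q : k × D) :
    augPrec prec y (augStar prec succ p q) = augPrec prec (augPrec prec y p) q := by
  simp only [augPrec_apply, augStar, map_add, map_smul, LinearMap.add_apply, LinearMap.smul_apply,
    hD.prec_prec]
  module

theorem augSucc_augStar (p q : k × D) (y : D) :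
    augSucc succ (augStar prec succ p q) y = augSucc succ p (augSucc succ q y) := by
  simp only [augSucc_apply, augStar, map_add, map_smul, LinearMap.add_apply, LinearMap.smul_apply,
    ← hD.succ_succ]
  module

theorem augPrec_augSucc (p : k × D) (y : D) (q : k × D) :
    augPrec prec (augSucc succ p y) q = augSucc succ p (augPrec prec y q) := by
  simp only [augPrec_apply, augSucc_apply, map_add, map_smul, LinearMap.add_apply,
    LinearMap.smul_apply, hD.succ_prec]
  module

end IsDendriform

namespace IsDendriformHom

variable {E : Type*} [AddCommGroup E] [Module k E] {precE succE : E →ₗ[k] E →ₗ[k] E}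
  {g : D →ₗ[k] E}

theorem map_augPrec (hg : IsDendriformHom prec succ precE succE g) (y : D) (p : k × D) :
    g (augPrec prec y p) = augPrec precE (g y) (p.map id g) := by
  simp [augPrec_apply, hg.map_prec]

theorem map_augSucc (hg : IsDendriformHom prec succ precE succE g) (p : k × D) (y : D) :
    g (augSucc succ p y) = augSucc succE (p.map id g) (g y) := by
  simp [augSucc_apply, hg.map_succ]

theorem isDendriform_of_injective (hg : IsDendriformHom prec succ precE succE g)
    (hinj : Function.Injective g) (hE : IsDendriform precE succE) : IsDendriform prec succ where
  prec_prec x y z := hinj <| by simp only [hg.map_prec, hg.map_succ, map_add g, hE.prec_prec]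
  succ_prec x y z := hinj <| by simp only [hg.map_prec, hg.map_succ, hE.succ_prec]
  succ_succ x y z := hinj <| by simp only [hg.map_prec, hg.map_succ, map_add g, hE.succ_succ]

end IsDendriformHom

end Augmentation

/-! ### Evaluation of trees -/

section TreeEval

variable {k D X : Type*} [CommRing k] [AddCommGroup D] [Module k D]

/-- The value of a tree in the augmentation of `D`, given by
`| ↦ (1, 0)` and `T^ℓ ∨_x T^r ↦ (0, (T^ℓ ≻ f x) ≺ T^r)`. -/
def treeEval (prec succ : D →ₗ[k] D →ₗ[k] D) (f : X → D) : BinaryTree X → k × D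
  | .nil => (1, 0)
  | .node x l r =>
      (0, augPrec prec (augSucc succ (treeEval prec succ f l) (f x)) (treeEval prec succ f r))

variable {prec succ : D →ₗ[k] D →ₗ[k] D} (f : X → D)

theorem treeEval_fst {T : BinaryTree X} (hT : T ≠ .nil) : (treeEval prec succ f T).1 = 0 := by
  cases T with
  | nil => exact absurd rfl hT
  | node => rfl

theorem augPrec_treeEval (y : D) {T : BinaryTree X} (hT : T ≠ .nil) :
    augPrec prec y (treeEval prec succ f T) = prec y (treeEval prec succ f T).2 := by
  rw [augPrec_apply, treeEval_fst f hT, zero_smul, zero_add]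

theorem augSucc_treeEval {T : BinaryTree X} (hT : T ≠ .nil) (y : D) :
    augSucc succ (treeEval prec succ f T) y = succ (treeEval prec succ f T).2 y := by
  rw [augSucc_apply, treeEval_fst f hT, zero_smul, zero_add]

theorem linearCombination_treeEval_node_right (x : X) (l : BinaryTree X) (s : BinaryTree X →₀ k) :
    Finsupp.linearCombination k (treeEval prec succ f) (s.mapDomain fun S => .node x l S) =
      (0, augPrec prec (augSucc succ (treeEval prec succ f l) (f x))
        (Finsupp.linearCombination k (treeEval prec succ f) s)) :=
  linearCombination_mapDomain_eq_map (v := treeEval prec succ f)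
    (LinearMap.inr k k D ∘ₗ augPrec prec (augSucc succ (treeEval prec succ f l) (f x)))
    (fun _ => by rfl) s

theorem linearCombination_treeEval_node_left (x : X) (r : BinaryTree X) (s : BinaryTree X →₀ k) :
    Finsupp.linearCombination k (treeEval prec succ f) (s.mapDomain fun S => .node x S r) =
      (0, augPrec prec (augSucc succ (Finsupp.linearCombination k (treeEval prec succ f) s) (f x))
        (treeEval prec succ f r)) :=
  linearCombination_mapDomain_eq_map (v := treeEval prec succ f)
    (LinearMap.inr k k D ∘ₗ (augPrec prec).flip (treeEval prec succ f r) ∘ₗ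
      (augSucc succ).flip (f x))
    (fun _ => by rfl) s

theorem IsDendriform.linearCombination_treeEval_treeStar (hD : IsDendriform prec succ)
    (T U : BinaryTree X) :
    Finsupp.linearCombination k (treeEval prec succ f) (treeStar k T U) =
      augStar prec succ (treeEval prec succ f T) (treeEval prec succ f U) := by
  match T, U with
  | .nil, U => rw [treeStar]; simp [treeEval, augStar]
  | .node x l r, .nil => rw [treeStar]; simp [treeEval, augStar]
  | .node x l r, .node y l' r' =>
    rw [treeStar, map_add, linearCombination_treeEval_node_right,
      linearCombination_treeEval_node_left,
      hD.linearCombination_treeEval_treeStar r (.node y l' r'),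
      hD.linearCombination_treeEval_treeStar (.node x l r) l', hD.augPrec_augStar,
      hD.augSucc_augStar, hD.augPrec_augSucc (treeEval prec succ f (.node x l r)),
      augPrec_treeEval f _ (T := .node y l' r') (by simp),
      augSucc_treeEval f (T := .node x l r) (by simp)]
    simp [treeEval, augStar]
termination_by sizeOf T + sizeOf U

theorem IsDendriformHom.map_treeEval {E : Type*} [AddCommGroup E] [Module k E]
    {precE succE : E →ₗ[k] E →ₗ[k] E} {g : D →ₗ[k] E}
    (hg : IsDendriformHom prec succ precE succE g) (T : BinaryTree X) :
    (treeEval prec succ f T).map id g = treeEval precE succE (g ∘ f) T := by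
  induction T with
  | nil => simp [treeEval]
  | node x l r ihl ihr =>
    simp [treeEval, hg.map_augPrec, hg.map_augSucc, ihl, ihr]

end TreeEval

namespace Dend

section Lift

variable {k D X : Type*} [CommRing k] [AddCommGroup D] [Module k D]

/-- The linear evaluation `Dend(V) → D` of trees; it is the homomorphism of dendriform dialgebras
induced by a map `f` on the basis `X` of `V`. -/
noncomputable def lift (prec succ : D →ₗ[k] D →ₗ[k] D) (f : X → D) : Dend k X →ₗ[k] D :=
  Finsupp.linearCombination k fun T => (treeEval prec succ f T.1).2

theorem lift_single (prec succ : D →ₗ[k] D →ₗ[k] D) (f : X → D) (T : NTree X) :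
    lift prec succ f (Finsupp.single T 1) = (treeEval prec succ f T.1).2 := by
  simp [lift]

theorem lift_isDendriformHom {prec succ : D →ₗ[k] D →ₗ[k] D} (hD : IsDendriform prec succ)
    (f : X → D) : IsDendriformHom (Dend.prec k X) (Dend.succ k X) prec succ (lift prec succ f) where
  map_prec := by
    refine map_bilinearExtension ?_
    rintro ⟨_ | ⟨x, l, r⟩, hT⟩ U
    · exact absurd rfl hT
    calc lift prec succ f (treePrec k ⟨.node x l r, hT⟩ U)
        = augPrec prec (augSucc succ (treeEval prec succ f l) (f x))
            (Finsupp.linearCombination k (treeEval prec succ f) (treeStar k r U.1)) :=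
          linearCombination_mapDomain_eq_map (v := treeEval prec succ f) (augPrec prec _)
            (fun _ => by rfl) _
      _ = augPrec prec (treeEval prec succ f (.node x l r)).2 (treeEval prec succ f U.1) := by
          rw [hD.linearCombination_treeEval_treeStar, hD.augPrec_augStar, treeEval]
      _ = prec _ _ := by rw [augPrec_treeEval f _ U.2, lift_single, lift_single]
  map_succ := by
    refine map_bilinearExtension ?_
    rintro T ⟨_ | ⟨y, l, r⟩, hU⟩
    · exact absurd rfl hU
    calc lift prec succ f (treeSucc k T ⟨.node y l r, hU⟩)
        = augPrec prec (augSucc succ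
            (Finsupp.linearCombination k (treeEval prec succ f) (treeStar k T.1 l)) (f y))
            (treeEval prec succ f r) :=
          linearCombination_mapDomain_eq_map (v := treeEval prec succ f)
            ((augPrec prec).flip (treeEval prec succ f r) ∘ₗ (augSucc succ).flip (f y))
            (fun _ => by rfl) _
      _ = augSucc succ (treeEval prec succ f T.1) (treeEval prec succ f (.node y l r)).2 := by
          rw [hD.linearCombination_treeEval_treeStar, hD.augSucc_augStar, hD.augPrec_augSucc,
            treeEval]
      _ = succ _ _ := by rw [augSucc_treeEval f T.2, lift_single, lift_single]

end Lift

variable {k X : Type*} [CommRing k]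

theorem prec_single_graft_nil (x : X) (l : BinaryTree X) (r : NTree X) :
    prec k X (Finsupp.single (NTree.graft x l .nil) 1) (Finsupp.single r 1) =
      Finsupp.single (NTree.graft x l r.1) 1 := by
  rw [prec, bilinearExtension_single, NTree.graft, treePrec, treeStar, Finsupp.mapDomain_single]

theorem succ_single_graft_nil_nil (l : NTree X) (x : X) :
    succ k X (Finsupp.single l 1) (Finsupp.single (NTree.graft x .nil .nil) 1) =
      Finsupp.single (NTree.graft x l.1 .nil) 1 := by
  obtain ⟨_ | ⟨y, l₁, l₂⟩, hl⟩ := l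
  · exact absurd rfl hl
  · rw [succ, bilinearExtension_single, NTree.graft, treeSucc, treeStar, Finsupp.mapDomain_single]

theorem treeEval_single (T : BinaryTree X) (hT : T ≠ .nil) :
    (treeEval (prec k X) (succ k X) (fun x => Finsupp.single (NTree.graft x .nil .nil) 1) T).2 =
      Finsupp.single ⟨T, hT⟩ 1 := by
  induction T with
  | nil => exact absurd rfl hT
  | node x l r ihl ihr =>
    have eval_left : augSucc (succ k X) (treeEval (prec k X) (succ k X)
        (fun x => Finsupp.single (NTree.graft x .nil .nil) 1) l)
        (Finsupp.single (NTree.graft x .nil .nil) 1) =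
        Finsupp.single (NTree.graft x l .nil) 1 := by
      by_cases hl : l = .nil
      · simp [hl, treeEval, augSucc_apply]
      · rw [augSucc_treeEval _ hl, ihl hl, succ_single_graft_nil_nil]
    rw [treeEval, eval_left]
    by_cases hr : r = .nil
    · simp [hr, treeEval, augPrec_apply, NTree.graft]
    · rw [augPrec_treeEval _ _ hr, ihr hr, prec_single_graft_nil, NTree.graft]

variable {D : Type*} [AddCommGroup D] [Module k D] {precD succD : D →ₗ[k] D →ₗ[k] D}

theorem eq_lift_of_isDendriformHom {g : Dend k X →ₗ[k] D}
    (hg : IsDendriformHom (prec k X) (succ k X) precD succD g) :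
    g = lift precD succD fun x => g (Finsupp.single (NTree.graft x .nil .nil) 1) := by
  refine Finsupp.lhom_ext' fun T => LinearMap.ext_ring ?_
  rw [LinearMap.comp_apply, LinearMap.comp_apply, Finsupp.lsingle_apply, lift_single,
    ← treeEval_single T.1 T.2]
  exact congrArg Prod.snd (hg.map_treeEval _ T.1)

variable {V : Type*} [AddCommGroup V] [Module k V] (b : Module.Basis X k V)

theorem incl_basis (x : X) : incl b (b x) = Finsupp.single (NTree.graft x .nil .nil) 1 := by
  simp [incl]

theorem existsUnique_lift (hD : IsDendriform precD succD) (f : V →ₗ[k] D) :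
    ∃! g : Dend k X →ₗ[k] D,
      IsDendriformHom (prec k X) (succ k X) precD succD g ∧ g ∘ₗ incl b = f := by
  refine ⟨lift precD succD (f ∘ b), ⟨lift_isDendriformHom hD _, b.ext fun x => ?_⟩, ?_⟩
  · simp [incl_basis, lift_single, NTree.graft, treeEval, augPrec_apply, augSucc_apply]
  · rintro g ⟨hg, rfl⟩
    refine (eq_lift_of_isDendriformHom hg).trans (congrArg _ (funext fun x => ?_))
    simp [incl_basis]

end Dend

/-! ### Rota-Baxter algebras of weight zero -/

section RotaBaxter

variable {k A : Type*} [CommRing k] [AddCommGroup A] [Module k A] {mul : A →ₗ[k] A →ₗ[k] A}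
  {R : A →ₗ[k] A}

theorem IsRotaBaxterAlgebra.isDendriform (hR : IsRotaBaxterAlgebra (0 : k) mul R) :
    IsDendriform (rbPrec mul R) (rbSucc mul R) where
  prec_prec x y z := by simp [rbPrec, rbSucc, hR.assoc, hR.rota_baxter, add_comm]
  succ_prec x y z := by simp [rbPrec, rbSucc, hR.assoc]
  succ_succ x y z := by simp [rbPrec, rbSucc, ← hR.assoc, hR.rota_baxter, add_comm]

theorem assoc_of_rota_baxter (hR : ∀ x y, mul (R x) (R y) = R (mul (R x) y + mul x (R y)))
    {x y z : A} (h₁ : mul (mul (R x) (R y)) z = mul (R x) (mul (R y) z))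
    (h₂ : mul (mul (R x) y) (R z) = mul (R x) (mul y (R z)))
    (h₃ : mul (mul x (R y)) (R z) = mul x (mul (R y) (R z))) :
    mul (mul (R x) (R y)) (R z) = mul (R x) (mul (R y) (R z)) := by
  calc mul (mul (R x) (R y)) (R z)
      = R (mul (mul (R x) (R y)) z + (mul (mul (R x) y) (R z) + mul (mul x (R y)) (R z))) := by
        rw [hR x y, hR, ← hR x y, map_add mul, LinearMap.add_apply]
    _ = R (mul (R x) (mul (R y) z) + mul (R x) (mul y (R z)) + mul x (mul (R y) (R z))) := by
        rw [h₁, h₂, h₃, add_assoc]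
    _ = mul (R x) (mul (R y) (R z)) := by
        rw [hR y z, hR, ← hR y z, map_add (mul (R x))]

end RotaBaxter

/-! ### The product of Rota-Baxter words -/

local notation:70 a:70 " ⋄ " b:71 => FreeRB.mul _ _ a b

namespace FreeRB

section Word

variable (k : Type*) {X : Type*} [CommRing k]

/-- A Rota-Baxter word as a basis element of the free Rota-Baxter algebra. -/
noncomputable def word {h : Bool} (w : RBWord X h) : FreeRB k X :=
  Finsupp.single ⟨h, w⟩ 1

variable (X) in
/-- The span of the Rota-Baxter words with head `h`: those beginning with a letter if `h` is
`false`, with a bracketed word if `h` is `true`. -/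
noncomputable def headed (h : Bool) : Submodule k (FreeRB k X) :=
  Submodule.span k (Set.range (word k (h := h)))

variable {k}

theorem hom_ext {M : Type*} [AddCommGroup M] [Module k M] {f g : FreeRB k X →ₗ[k] M}
    (hfg : ∀ {h : Bool} (w : RBWord X h), f (word k w) = g (word k w)) : f = g :=
  Finsupp.lhom_ext' fun w => LinearMap.ext_ring (hfg w.2)

theorem mem_span_word (a : FreeRB k X) :
    a ∈ Submodule.span k (Set.range fun w : RBWords X => word k w.2) := by
  simpa [word] using (Finsupp.basisSingleOne (R := k)).mem_span a

theorem op_mem_span_op_word (a : FreeRB k X) :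
    op k X a ∈ Submodule.span k (Set.range fun w : RBWords X => op k X (word k w.2)) := by
  rw [Set.range_comp' (op k X), ← Submodule.map_span]
  exact Submodule.mem_map_of_mem (mem_span_word a)

theorem word_mem_headed {h : Bool} (w : RBWord X h) : word k w ∈ headed k X h :=
  Submodule.subset_span ⟨w, rfl⟩

theorem word_mul_word {h h' : Bool} (w : RBWord X h) (w' : RBWord X h') :
    word k w ⋄ word k w' = Finsupp.linearCombination k (word k) (RBWord.mul k w w') := by
  rw [mul, word, word, bilinearExtension_single]
  simp [Finsupp.mapDomain, Finsupp.linearCombination_apply, word]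

theorem mul_mem_headed {h : Bool} {u : FreeRB k X} (hu : u ∈ headed k X h) (q : FreeRB k X) :
    u ⋄ q ∈ headed k X h := by
  induction hu, mem_span_word q using Submodule.span_induction₂ with
  | mem_mem _ _ hw hw' =>
    obtain ⟨⟨w, rfl⟩, ⟨w', rfl⟩⟩ := hw, hw'
    rw [word_mul_word, headed, ← Finsupp.range_linearCombination]
    exact LinearMap.mem_range_self _ _
  | zero_left | zero_right => simp
  | add_left | add_right => simp [add_mem, *]
  | smul_left | smul_right => simp [Submodule.smul_mem, *]

theorem word_bracket {h : Bool} (w : RBWord X h) : word k (.bracket w) = op k X (word k w) := by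
  simp [word, op]

theorem word_letterCons (x : X) (u : RBWord X true) :
    word k (.letterCons x u) = word k (.letter x) ⋄ word k u := by
  rw [word_mul_word]
  cases u <;> rw [RBWord.mul, Finsupp.linearCombination_single, one_smul]

theorem word_bracketCons {h : Bool} (w : RBWord X h) (u : RBWord X false) :
    word k (.bracketCons w u) = op k X (word k w) ⋄ word k u := by
  rw [← word_bracket, word_mul_word]
  cases u <;> rw [RBWord.mul, Finsupp.linearCombination_single, one_smul]

theorem letter_mul_mul (x : X) {u : FreeRB k X} (hu : u ∈ headed k X true) (q : FreeRB k X) :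
    word k (.letter x) ⋄ u ⋄ q = word k (.letter x) ⋄ (u ⋄ q) := by
  refine mul_assoc_on_span ?_ (Submodule.mem_span_singleton_self _) hu (mem_span_word q)
  rintro _ rfl _ ⟨u, rfl⟩ _ ⟨w, rfl⟩
  rw [← word_letterCons, word_mul_word, word_mul_word, RBWord.mul]
  exact linearCombination_mapDomain_eq_map _ (word_letterCons x) _

theorem op_mul_mul (a : FreeRB k X) {u : FreeRB k X} (hu : u ∈ headed k X false)
    (q : FreeRB k X) : op k X a ⋄ u ⋄ q = op k X a ⋄ (u ⋄ q) := by
  refine mul_assoc_on_span ?_ (op_mem_span_op_word a) hu (mem_span_word q)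
  rintro _ ⟨c, rfl⟩ _ ⟨u, rfl⟩ _ ⟨w, rfl⟩
  rw [← word_bracketCons, word_mul_word, word_mul_word, RBWord.mul]
  exact linearCombination_mapDomain_eq_map _ (word_bracketCons c.2) _

theorem letter_mul_eq_zero (x : X) {u : FreeRB k X} (hu : u ∈ headed k X false) :
    word k (.letter x) ⋄ u = 0 := by
  induction hu using Submodule.span_induction with
  | mem _ hu =>
    obtain ⟨u, rfl⟩ := hu
    rw [word_mul_word]
    cases u <;> rw [RBWord.mul, map_zero]
  | zero | add | smul => simp [*]

theorem op_mul_op (a b : FreeRB k X) :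
    op k X a ⋄ op k X b = op k X (op k X a ⋄ b + a ⋄ op k X b) := by
  have h_maps : (mul k X).compl₁₂ (op k X) (op k X) =
      (mul k X ∘ₗ op k X + (mul k X).compl₂ (op k X)).compr₂ (op k X) := by
    refine hom_ext fun c => hom_ext fun c' => ?_
    simp only [LinearMap.compl₁₂_apply, LinearMap.compr₂_apply, LinearMap.add_apply,
      LinearMap.comp_apply, LinearMap.compl₂_apply, ← word_bracket, word_mul_word, RBWord.mul,
      map_add]
    exact congrArg₂ _ (linearCombination_mapDomain_eq_map _ word_bracket _)
      (linearCombination_mapDomain_eq_map _ word_bracket _)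
  exact LinearMap.congr_fun₂ h_maps a b

theorem op_mul_op_mul (a b : FreeRB k X) {v : FreeRB k X} (hv : v ∈ headed k X false) :
    op k X a ⋄ op k X b ⋄ v = op k X a ⋄ (op k X b ⋄ v) := by
  refine mul_assoc_on_span ?_ (op_mem_span_op_word a) (op_mem_span_op_word b) hv
  rintro _ ⟨c, rfl⟩ _ ⟨c', rfl⟩ _ ⟨v, rfl⟩
  have op_mul_word {h : Bool} (p : RBWord X h →₀ k) :
      op k X (Finsupp.linearCombination k (word k) p) ⋄ word k v =
        Finsupp.linearCombination k (word k) (p.mapDomain fun d => .bracketCons d v) :=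
    (linearCombination_mapDomain_eq_map (v := word k) ((mul k X).flip (word k v) ∘ₗ op k X)
      (fun d => by exact word_bracketCons d v) p).symm
  beta_reduce
  rw [op_mul_op, map_add, map_add, LinearMap.add_apply, ← word_bracketCons, ← word_bracket,
    ← word_bracket, word_mul_word, word_mul_word, word_mul_word, RBWord.mul, map_add, op_mul_word,
    op_mul_word]

theorem word_mul_assoc : ∀ {h₁ h₂ h₃ : Bool} (w₁ : RBWord X h₁) (w₂ : RBWord X h₂)
    (w₃ : RBWord X h₃), word k w₁ ⋄ word k w₂ ⋄ word k w₃ = word k w₁ ⋄ (word k w₂ ⋄ word k w₃)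
  | _, _, _, .letterCons x u, w₂, w₃ => by
    have hu := word_mem_headed (k := k) u
    rw [word_letterCons, letter_mul_mul x hu, letter_mul_mul x (mul_mem_headed hu _),
      word_mul_assoc u w₂ w₃, letter_mul_mul x hu]
  | _, _, _, .bracketCons c u, w₂, w₃ => by
    have hu := word_mem_headed (k := k) u
    rw [word_bracketCons, op_mul_mul _ hu, op_mul_mul _ (mul_mem_headed hu _),
      word_mul_assoc u w₂ w₃, op_mul_mul _ hu]
  | _, true, _, .letter x, w₂, w₃ => letter_mul_mul x (word_mem_headed w₂) _
  | _, false, _, .letter x, w₂, w₃ => by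
    have hw₂ := word_mem_headed (k := k) w₂
    rw [letter_mul_eq_zero x hw₂, letter_mul_eq_zero x (mul_mem_headed hw₂ _), map_zero,
      LinearMap.zero_apply]
  | _, false, _, .bracket c, w₂, w₃ => by
    rw [word_bracket, op_mul_mul _ (word_mem_headed w₂)]
  | _, _, _, .bracket c, .bracketCons d v, w₃ => by
    have hv := word_mem_headed (k := k) v
    rw [word_bracket, word_bracketCons, ← op_mul_op_mul _ _ hv, op_mul_mul _ hv,
      ← op_mul_op_mul _ _ (mul_mem_headed hv _), op_mul_op, op_mul_mul _ hv]
  | _, _, false, .bracket c, .bracket d, w₃ => by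
    rw [word_bracket, word_bracket, op_mul_op_mul _ _ (word_mem_headed w₃)]
  | _, _, _, .bracket c, .bracket d, .bracket e => by
    have h₁ := word_mul_assoc (.bracket c) (.bracket d) e
    have h₂ := word_mul_assoc (.bracket c) d (.bracket e)
    have h₃ := word_mul_assoc c (.bracket d) (.bracket e)
    simp only [word_bracket] at h₁ h₂ h₃ ⊢
    exact assoc_of_rota_baxter op_mul_op h₁ h₂ h₃
  | _, _, _, .bracket c, .bracket d, .bracketCons e v => by
    -- makes the bracketed first factor smaller than the whole word in the termination proof
    have : 0 < sizeOf v := by cases v <;> simp +arith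
    have h := word_mul_assoc (.bracket c) (.bracket d) (.bracket e)
    have hv := word_mem_headed (k := k) v
    simp only [word_bracket] at h
    rw [word_bracket, word_bracket, word_bracketCons, ← op_mul_op_mul (word k d) _ hv,
      op_mul_op (word k c), ← op_mul_op_mul _ _ hv, ← op_mul_op, h, op_mul_op (word k d),
      op_mul_op_mul _ _ hv]
termination_by _ _ _ w₁ w₂ w₃ => sizeOf w₁ + sizeOf w₂ + sizeOf w₃

theorem mul_assoc (a b c : FreeRB k X) : a ⋄ b ⋄ c = a ⋄ (b ⋄ c) :=
  mul_assoc_on_span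
    (by rintro _ ⟨w₁, rfl⟩ _ ⟨w₂, rfl⟩ _ ⟨w₃, rfl⟩; exact word_mul_assoc w₁.2 w₂.2 w₃.2)
    (mem_span_word a) (mem_span_word b) (mem_span_word c)

variable (k X)

theorem isRotaBaxterAlgebra : IsRotaBaxterAlgebra (0 : k) (mul k X) (op k X) where
  assoc := mul_assoc
  rota_baxter a b := by rw [op_mul_op, zero_smul, add_zero]

theorem isDendriform : IsDendriform (prec k X) (succ k X) :=
  (isRotaBaxterAlgebra k X).isDendriform

end Word

end FreeRB

/-! ### Evaluation of Rota-Baxter words -/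

namespace RBWord

/-- The value of a Rota-Baxter word in the algebra `A` with product `mulA` and operator `RA`, given
the values `f` of the letters. -/
def eval {k A X : Type*} [CommRing k] [AddCommGroup A] [Module k A]
    (mulA : A →ₗ[k] A →ₗ[k] A) (RA : A →ₗ[k] A) (f : X → A) : {h : Bool} → RBWord X h → A
  | _, .letter x => f x
  | _, .letterCons x u => mulA (f x) (eval mulA RA f u)
  | _, .bracket w => RA (eval mulA RA f w)
  | _, .bracketCons w u => mulA (RA (eval mulA RA f w)) (eval mulA RA f u)

end RBWord

namespace FreeRB

section Lift

variable {k A X : Type*} [CommRing k] [AddCommGroup A] [Module k A]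

/-- The linear evaluation `RB(V) → A` of Rota-Baxter words; it is the homomorphism of Rota-Baxter
algebras induced by a map `f` on the basis `X` of `V` with `f x * f y = 0`. -/
noncomputable def lift (mulA : A →ₗ[k] A →ₗ[k] A) (RA : A →ₗ[k] A) (f : X → A) :
    FreeRB k X →ₗ[k] A :=
  Finsupp.linearCombination k fun w => w.2.eval mulA RA f

variable {mulA : A →ₗ[k] A →ₗ[k] A} {RA : A →ₗ[k] A} {f : X → A}

theorem lift_word {h : Bool} (w : RBWord X h) :
    lift mulA RA f (word k w) = w.eval mulA RA f := by
  simp [lift, word]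

theorem lift_op (a : FreeRB k X) : lift mulA RA f (op k X a) = RA (lift mulA RA f a) := by
  have h_maps : lift mulA RA f ∘ₗ op k X = RA ∘ₗ lift mulA RA f := by
    refine hom_ext fun w => ?_
    rw [LinearMap.comp_apply, LinearMap.comp_apply, ← word_bracket, lift_word, lift_word,
      RBWord.eval]
  exact LinearMap.congr_fun h_maps a

theorem lift_letter_mul (x : X) {u : FreeRB k X} (hu : u ∈ headed k X true) :
    lift mulA RA f (word k (.letter x) ⋄ u) =
      mulA (lift mulA RA f (word k (.letter x))) (lift mulA RA f u) := by
  refine map_mul_on_span ?_ (Submodule.mem_span_singleton_self _) hu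
  rintro _ rfl _ ⟨u, rfl⟩
  rw [← word_letterCons, lift_word, lift_word, lift_word, RBWord.eval, RBWord.eval]

theorem lift_op_mul (a : FreeRB k X) {u : FreeRB k X} (hu : u ∈ headed k X false) :
    lift mulA RA f (op k X a ⋄ u) = mulA (lift mulA RA f (op k X a)) (lift mulA RA f u) := by
  refine map_mul_on_span ?_ (op_mem_span_op_word a) hu
  rintro _ ⟨w, rfl⟩ _ ⟨u, rfl⟩
  beta_reduce
  rw [← word_bracketCons, ← word_bracket, lift_word, lift_word, lift_word, RBWord.eval,
    RBWord.eval]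

section RotaBaxter

variable (hA : IsRotaBaxterAlgebra (0 : k) mulA RA) (hf : ∀ x y, mulA (f x) (f y) = 0)
include hA hf

theorem mul_eval_eq_zero (x : X) (u : RBWord X false) : mulA (f x) (u.eval mulA RA f) = 0 := by
  cases u with
  | letter y => exact hf x y
  | letterCons y v => rw [RBWord.eval, ← hA.assoc, hf, map_zero, LinearMap.zero_apply]

theorem lift_word_mul_word : ∀ {h h' : Bool} (w : RBWord X h) (w' : RBWord X h'),
    lift mulA RA f (word k w ⋄ word k w') =
      mulA (lift mulA RA f (word k w)) (lift mulA RA f (word k w'))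
  | _, _, .letterCons x u, w' => by
    have hu := word_mem_headed (k := k) u
    rw [word_letterCons, letter_mul_mul x hu, lift_letter_mul x (mul_mem_headed hu _),
      lift_word_mul_word u w', lift_letter_mul x hu, hA.assoc]
  | _, _, .bracketCons c u, w' => by
    have hu := word_mem_headed (k := k) u
    rw [word_bracketCons, op_mul_mul _ hu, lift_op_mul _ (mul_mem_headed hu _),
      lift_word_mul_word u w', lift_op_mul _ hu, hA.assoc]
  | _, true, .letter x, w' => lift_letter_mul x (word_mem_headed w')
  | _, false, .letter x, w' => by
    rw [letter_mul_eq_zero x (word_mem_headed w'), map_zero, lift_word, lift_word, RBWord.eval,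
      mul_eval_eq_zero hA hf]
  | _, false, .bracket c, w' => by
    rw [word_bracket, lift_op_mul _ (word_mem_headed w')]
  | _, _, .bracket c, .bracket d => by
    have h_left := lift_word_mul_word (.bracket c) d
    have h_right := lift_word_mul_word c (.bracket d)
    simp only [word_bracket, lift_op] at h_left h_right ⊢
    rw [op_mul_op, lift_op, map_add, h_left, h_right, hA.rota_baxter, zero_smul, add_zero]
  | _, _, .bracket c, .bracketCons d v => by
    -- makes the bracketed first factor smaller than the whole word in the termination proof
    have : 0 < sizeOf v := by cases v <;> simp +arith
    have h := lift_word_mul_word (.bracket c) (.bracket d)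
    have hv := word_mem_headed (k := k) v
    simp only [word_bracket] at h
    rw [word_bracket, word_bracketCons, ← op_mul_op_mul _ _ hv, op_mul_op, lift_op_mul _ hv,
      ← op_mul_op, h, hA.assoc, lift_op_mul _ hv]
termination_by _ _ w w' => sizeOf w + sizeOf w'

theorem lift_isAlgebraHom : IsAlgebraHom (mul k X) mulA (lift mulA RA f) := fun a b =>
  map_mul_on_span
    (by rintro _ ⟨w, rfl⟩ _ ⟨w', rfl⟩; exact lift_word_mul_word hA hf w.2 w'.2)
    (mem_span_word a) (mem_span_word b)

end RotaBaxter

theorem eq_lift {g : FreeRB k X →ₗ[k] A} (hg : IsAlgebraHom (mul k X) mulA g)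
    (hgR : ∀ a, g (op k X a) = RA (g a)) :
    g = lift mulA RA fun x => g (word k (.letter x)) := by
  refine hom_ext fun w => ?_
  rw [lift_word]
  induction w with
  | letter x => rfl
  | letterCons x u ih => rw [word_letterCons, hg, ih, RBWord.eval]
  | bracket w ih => rw [word_bracket, hgR, ih, RBWord.eval]
  | bracketCons w u ihw ihu => rw [word_bracketCons, hg, hgR, ihw, ihu, RBWord.eval]

end Lift

section Free

variable {k V X : Type*} [CommRing k] [AddCommGroup V] [Module k V] (b : Module.Basis X k V)

theorem incl_basis (x : X) : incl b (b x) = word k (.letter x) := by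
  simp [incl, word]

theorem incl_isAlgebraHom : IsAlgebraHom (0 : V →ₗ[k] V →ₗ[k] V) (mul k X) (incl b) := by
  have h_maps : (mul k X).compl₁₂ (incl b) (incl b) = 0 := by
    refine b.ext fun x => b.ext fun y => ?_
    rw [LinearMap.compl₁₂_apply, incl_basis, incl_basis,
      letter_mul_eq_zero x (word_mem_headed _), LinearMap.zero_apply, LinearMap.zero_apply]
  intro x y
  simpa using (LinearMap.congr_fun₂ h_maps x y).symm

theorem existsUnique_lift {A : Type*} [AddCommGroup A] [Module k A] {mulA : A →ₗ[k] A →ₗ[k] A}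
    {RA : A →ₗ[k] A} (hA : IsRotaBaxterAlgebra (0 : k) mulA RA) {f : V →ₗ[k] A}
    (hf : IsAlgebraHom (0 : V →ₗ[k] V →ₗ[k] V) mulA f) :
    ∃! g : FreeRB k X →ₗ[k] A,
      (IsAlgebraHom (mul k X) mulA g ∧ ∀ a, g (op k X a) = RA (g a)) ∧ g ∘ₗ incl b = f := by
  have hf_basis (x y : X) : mulA (f (b x)) (f (b y)) = 0 := by
    simpa using (hf (b x) (b y)).symm
  refine ⟨lift mulA RA (f ∘ b), ⟨⟨lift_isAlgebraHom hA hf_basis, lift_op⟩, b.ext fun x => ?_⟩, ?_⟩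
  · rw [LinearMap.comp_apply, incl_basis, lift_word, RBWord.eval, Function.comp_apply]
  · rintro g ⟨⟨hg, hgR⟩, rfl⟩
    refine (eq_lift hg hgR).trans (congrArg _ (funext fun x => ?_))
    rw [Function.comp_apply, LinearMap.comp_apply, incl_basis]

end Free

end FreeRB

/-! ### The homomorphism `φ` -/

section Phi

variable {k X : Type*} [CommRing k]

theorem FreeRB.prec_letter_word (x : X) {h : Bool} (w : RBWord X h) :
    FreeRB.prec k X (FreeRB.word k (.letter x)) (FreeRB.word k w) =
      FreeRB.word k (.letterCons x (.bracket w)) := by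
  rw [FreeRB.word_letterCons, FreeRB.word_bracket, FreeRB.prec, rbPrec, LinearMap.compl₂_apply]

theorem FreeRB.succ_word_word {h : Bool} (w : RBWord X h) (u : RBWord X false) :
    FreeRB.succ k X (FreeRB.word k w) (FreeRB.word k u) = FreeRB.word k (.bracketCons w u) := by
  rw [FreeRB.word_bracketCons, FreeRB.succ, rbSucc, LinearMap.comp_apply]

theorem treeEval_eq_word_treeWord : ∀ (T : BinaryTree X) (hT : T ≠ .nil),
    (treeEval (FreeRB.prec k X) (FreeRB.succ k X) (fun x => FreeRB.word k (.letter x)) T).2 =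
      FreeRB.word k (treeWord T hT).2
  | .nil, hT => absurd rfl hT
  | .node x .nil .nil, _ => by
    simp [treeEval, treeWord, augPrec_apply, augSucc_apply]
  | .node x .nil (.node z r₁ r₂), _ => by
    rw [treeEval, augPrec_treeEval _ _ (by simp),
      treeEval_eq_word_treeWord (.node z r₁ r₂) (by simp)]
    simp [treeEval, treeWord, augSucc_apply, FreeRB.prec_letter_word]
  | .node x (.node y l₁ l₂) .nil, _ => by
    rw [treeEval, augSucc_treeEval _ (by simp),
      treeEval_eq_word_treeWord (.node y l₁ l₂) (by simp)]
    simp [treeEval, treeWord, augPrec_apply, FreeRB.succ_word_word]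
  | .node x (.node y l₁ l₂) (.node z r₁ r₂), _ => by
    rw [treeEval, augPrec_treeEval _ _ (by simp), augSucc_treeEval _ (by simp),
      (FreeRB.isDendriform k X).succ_prec, treeEval_eq_word_treeWord (.node y l₁ l₂),
      treeEval_eq_word_treeWord (.node z r₁ r₂), FreeRB.prec_letter_word, FreeRB.succ_word_word,
      treeWord]

theorem dendToRB_comp_incl {V : Type*} [AddCommGroup V] [Module k V] (b : Module.Basis X k V) :
    dendToRB k X ∘ₗ Dend.incl b = FreeRB.incl b := by
  refine b.ext fun x => ?_
  rw [LinearMap.comp_apply, Dend.incl_basis, FreeRB.incl_basis, dendToRB,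
    Finsupp.lmapDomain_apply, Finsupp.mapDomain_single, NTree.graft, treeWord, FreeRB.word]

/-- The tree encoded by a dendriform diword, recovering `T` from its word `φ(T)`; the values on
the other Rota-Baxter words are irrelevant. -/
def RBWord.toTree : {h : Bool} → RBWord X h → BinaryTree X
  | _, .letter x => .node x .nil .nil
  | _, .letterCons x u => .node x .nil u.toTree
  | _, .bracket w => w.toTree
  | _, .bracketCons w (.letter x) => .node x w.toTree .nil
  | _, .bracketCons w (.letterCons x u) => .node x w.toTree u.toTree

theorem RBWord.toTree_treeWord : ∀ (T : BinaryTree X) (hT : T ≠ .nil), (treeWord T hT).2.toTree = T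
  | .nil, hT => absurd rfl hT
  | .node x .nil .nil, _ => by simp only [treeWord, toTree]
  | .node x .nil (.node z r₁ r₂), _ => by
    simp only [treeWord, toTree, toTree_treeWord (.node z r₁ r₂)]
  | .node x (.node y l₁ l₂) .nil, _ => by
    simp only [treeWord, toTree, toTree_treeWord (.node y l₁ l₂)]
  | .node x (.node y l₁ l₂) (.node z r₁ r₂), _ => by
    simp only [treeWord, toTree, toTree_treeWord (.node y l₁ l₂),
      toTree_treeWord (.node z r₁ r₂)]

variable (k X)

theorem treeWord_injective : Function.Injective fun T : NTree X => treeWord T.1 T.2 :=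
  fun T U h => Subtype.ext <| by
    rw [← RBWord.toTree_treeWord T.1 T.2, ← RBWord.toTree_treeWord U.1 U.2]
    exact congrArg (fun w : RBWords X => w.2.toTree) h

theorem dendToRB_eq_lift :
    dendToRB k X =
      Dend.lift (FreeRB.prec k X) (FreeRB.succ k X) fun x => FreeRB.word k (.letter x) := by
  refine Finsupp.lhom_ext' fun T => LinearMap.ext_ring ?_
  rw [LinearMap.comp_apply, LinearMap.comp_apply, Finsupp.lsingle_apply, Dend.lift_single,
    treeEval_eq_word_treeWord T.1 T.2, dendToRB, Finsupp.lmapDomain_apply,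
    Finsupp.mapDomain_single, FreeRB.word]

theorem dendToRB_isDendriformHom :
    IsDendriformHom (Dend.prec k X) (Dend.succ k X) (FreeRB.prec k X) (FreeRB.succ k X)
      (dendToRB k X) := by
  rw [dendToRB_eq_lift]
  exact Dend.lift_isDendriformHom (FreeRB.isDendriform k X) _

theorem dendToRB_injective : Function.Injective (dendToRB k X) :=
  Finsupp.mapDomain_injective (treeWord_injective X)

theorem Dend.isDendriform : IsDendriform (Dend.prec k X) (Dend.succ k X) :=
  (dendToRB_isDendriformHom k X).isDendriform_of_injective (dendToRB_injective k X)
    (FreeRB.isDendriform k X)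

end Phi

/-! ### Dendriform diwords -/

namespace BracketLetter

variable {X : Type*}

/-- One step of the reading of a word over `X ∪ {⌊, ⌋}`. The state lists, for the open bracket
levels from the innermost to the outermost, whether a letter has been read at that level. The
reading fails when a level gets a second letter or closes without a letter. -/
def scanStep : List Bool → BracketLetter X → Option (List Bool)
  | S, lb => some (false :: S)
  | false :: S, var _ => some (true :: S)
  | true :: S, rb => some S
  | _, _ => none

/-- The reading of a word over `X ∪ {⌊, ⌋}` from the state `S`, which tests that each of its bracket
levels holds exactly one letter. -/
def scan (S : List Bool) (l : List (BracketLetter X)) : Option (List Bool) :=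
  l.foldlM scanStep S

theorem scan_nil (S : List Bool) : scan S ([] : List (BracketLetter X)) = some S := rfl

theorem scan_cons (S : List Bool) (a : BracketLetter X) (l : List (BracketLetter X)) :
    scan S (a :: l) = (scanStep S a).bind (scan · l) :=
  List.foldlM_cons

theorem scan_append (S : List Bool) (l l' : List (BracketLetter X)) :
    scan S (l ++ l') = (scan S l).bind (scan · l') :=
  List.foldlM_append

theorem scan_eq_none_of_infix {l l' : List (BracketLetter X)} (hl : ∀ S, scan S l = none)
    (h : l <:+: l') (S : List Bool) : scan S l' = none := by
  obtain ⟨s, t, rfl⟩ := h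
  simp [scan_append, hl]

theorem scan_of_scan_bracket_append {l t : List (BracketLetter X)} {S S' : List Bool}
    (hl : ∀ T, scan (false :: S) l = some T → ∃ b, T = b :: S)
    (h : scan S (lb :: (l ++ rb :: t)) = some S') : scan S t = some S' := by
  obtain ⟨T, hT, h⟩ : ∃ T, scan (false :: S) l = some T ∧ scan T (rb :: t) = some S' := by
    simpa only [scan_cons, scanStep, scan_append, Option.bind_some, Option.bind_eq_some_iff] using h
  obtain ⟨b, rfl⟩ := hl T hT
  cases b
  · simp [scan_cons, scanStep] at h
  · exact h

theorem exists_of_scan_spell {h : Bool} (w : RBWord X h) {b : Bool} {S S' : List Bool}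
    (hS : scan (b :: S) w.spell = some S') : ∃ b', S' = b' :: S := by
  induction w generalizing b S S' with
  | letter x =>
    cases b
    · exact ⟨true, (Option.some_inj.1 hS).symm⟩
    · simp [RBWord.spell, scan_cons, scanStep] at hS
  | letterCons x u ih =>
    cases b
    · exact ih hS
    · simp [RBWord.spell, scan_cons, scanStep] at hS
  | bracket w ih =>
    exact ⟨b, (Option.some_inj.1 (scan_of_scan_bracket_append (fun _ => ih) hS)).symm⟩
  | bracketCons w u ihw ihu => exact ihu (scan_of_scan_bracket_append (fun _ => ihw) hS)

theorem scan_of_scan_bracket_spell_append {h : Bool} (w : RBWord X h) {t : List (BracketLetter X)}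
    {S S' : List Bool} (hS : scan S (lb :: (w.spell ++ rb :: t)) = some S') :
    scan S t = some S' :=
  scan_of_scan_bracket_append (fun _ => exists_of_scan_spell w) hS

theorem scan_bracket_bracket {h : Bool} (w : RBWord X h) (S : List Bool) :
    scan S ([lb, lb] ++ w.spell ++ [rb, rb]) = none := by
  refine Option.eq_none_iff_forall_ne_some.2 fun S' hS => ?_
  have h_empty : scan (false :: S) ([rb] : List (BracketLetter X)) = some S' :=
    scan_of_scan_bracket_spell_append w (by simpa [scan_cons S, scanStep] using hS)
  simp [scan_cons, scanStep] at h_empty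

theorem scan_letter_bracket_letter (x y : X) {h : Bool} (w : RBWord X h) (S : List Bool) :
    scan S ([var x, lb] ++ w.spell ++ [rb, var y]) = none := by
  refine Option.eq_none_iff_forall_ne_some.2 fun S' hS => ?_
  obtain - | ⟨_ | _, S⟩ := S
  · simp [scan_cons, scanStep] at hS
  · have h_second : scan (true :: S) [var y] = some S' :=
      scan_of_scan_bracket_spell_append w (by simpa [scan_cons (false :: S), scanStep] using hS)
    simp [scan_cons, scanStep] at h_second
  · simp [scan_cons, scanStep] at hS

theorem scan_spell_treeWord : ∀ (T : BinaryTree X) (hT : T ≠ .nil) (S : List Bool),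
    scan (false :: S) (treeWord T hT).2.spell = some (true :: S)
  | .nil, hT, _ => absurd rfl hT
  | .node x .nil .nil, _, S => by
    simp [treeWord, RBWord.spell, scan_cons, scan_nil, scanStep]
  | .node x .nil (.node z r₁ r₂), _, S => by
    simp [treeWord, RBWord.spell, scan_cons, scan_nil, scan_append, scanStep,
      scan_spell_treeWord (.node z r₁ r₂)]
  | .node x (.node y l₁ l₂) .nil, _, S => by
    simp [treeWord, RBWord.spell, scan_cons, scan_nil, scan_append, scanStep,
      scan_spell_treeWord (.node y l₁ l₂)]
  | .node x (.node y l₁ l₂) (.node z r₁ r₂), _, S => by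
    simp [treeWord, RBWord.spell, scan_cons, scan_nil, scan_append, scanStep,
      scan_spell_treeWord (.node y l₁ l₂), scan_spell_treeWord (.node z r₁ r₂)]

end BracketLetter

section Diword

variable {X : Type*}

open BracketLetter

theorem isDiword_treeWord (T : BinaryTree X) (hT : T ≠ .nil) : IsDiword (treeWord T hT) where
  not_bracket w h := by
    have h_scan := scan_spell_treeWord T hT []
    rw [h] at h_scan
    simpa [scan_nil] using scan_of_scan_bracket_spell_append w.2 h_scan
  not_bracket_bracket w h := by
    simpa [scan_spell_treeWord] using scan_eq_none_of_infix (scan_bracket_bracket w.2) h [false]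
  not_letter_bracket_letter x y w h := by
    simpa [scan_spell_treeWord] using
      scan_eq_none_of_infix (scan_letter_bracket_letter x y w.2) h [false]

namespace IsDiword

variable {u : RBWords X} (hu : IsDiword u)
include hu

theorem of_bracket_infix {h : Bool} (w : RBWord X h)
    (hw : (RBWord.bracket w).spell <:+: u.2.spell) : IsDiword ⟨h, w⟩ where
  not_bracket v h_eq := by
    obtain ⟨rfl, h_eq⟩ := Sigma.mk.inj_iff.1 h_eq
    obtain rfl := eq_of_heq h_eq
    exact hu.not_bracket_bracket v (by simpa [RBWord.spell] using hw)
  not_bracket_bracket v hv :=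
    hu.not_bracket_bracket v (hv.trans (.trans ⟨[lb], [rb], rfl⟩ hw))
  not_letter_bracket_letter x y v hv :=
    hu.not_letter_bracket_letter x y v (hv.trans (.trans ⟨[lb], [rb], rfl⟩ hw))

theorem exists_eq_bracket {x : X} {v : RBWord X true}
    (hv : (RBWord.letterCons x v).spell <:+: u.2.spell) :
    ∃ (h : Bool) (w : RBWord X h), v = .bracket w := by
  cases v with
  | @bracket h w => exact ⟨h, w, rfl⟩
  | bracketCons w v =>
    exfalso
    cases v with
    | letter y =>
      exact hu.not_letter_bracket_letter x y ⟨_, w⟩ (by simpa [RBWord.spell] using hv)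
    | letterCons y v =>
      refine hu.not_letter_bracket_letter x y ⟨_, w⟩ (.trans ⟨[], v.spell, ?_⟩ hv)
      simp [RBWord.spell]

end IsDiword

theorem IsDiword.exists_treeWord_eq : ∀ {h : Bool} (u : RBWord X h), IsDiword ⟨h, u⟩ →
    ∃ x l r, treeWord (.node x l r) (by simp) = ⟨h, u⟩
  | _, .letter x, _ => ⟨x, .nil, .nil, by rw [treeWord]⟩
  | _, .letterCons x v, hu => by
    obtain ⟨_, w, rfl⟩ := hu.exists_eq_bracket (x := x) (v := v) List.infix_rfl
    obtain ⟨z, r₁, r₂, hr⟩ := exists_treeWord_eq w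
      (hu.of_bracket_infix w ⟨[.var x], [], by simp [RBWord.spell]⟩)
    exact ⟨x, .nil, .node z r₁ r₂, by rw [treeWord, hr]⟩
  | _, .bracket w, hu => absurd rfl (hu.not_bracket ⟨_, w⟩)
  | _, .bracketCons w (.letter x), hu => by
    obtain ⟨y, l₁, l₂, hl⟩ := exists_treeWord_eq w
      (hu.of_bracket_infix w ⟨[], [.var x], by simp [RBWord.spell]⟩)
    exact ⟨x, .node y l₁ l₂, .nil, by rw [treeWord, hl]⟩
  | _, .bracketCons w (.letterCons x v), hu => by
    obtain ⟨_, v, rfl⟩ := hu.exists_eq_bracket (x := x) (v := v)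
      ⟨(RBWord.bracket w).spell, [], by simp [RBWord.spell]⟩
    obtain ⟨y, l₁, l₂, hl⟩ := exists_treeWord_eq w
      (hu.of_bracket_infix w ⟨[], .var x :: (RBWord.bracket v).spell, by simp [RBWord.spell]⟩)
    obtain ⟨z, r₁, r₂, hr⟩ := exists_treeWord_eq v
      (hu.of_bracket_infix v ⟨(RBWord.bracket w).spell ++ [.var x], [], by simp [RBWord.spell]⟩)
    exact ⟨x, .node y l₁ l₂, .node z r₁ r₂, by rw [treeWord, hl, hr]⟩

variable (X) in
theorem range_treeWord :
    Set.range (fun T : NTree X => treeWord T.1 T.2) = {u : RBWords X | IsDiword u} := by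
  ext u
  constructor
  · rintro ⟨T, rfl⟩
    exact isDiword_treeWord T.1 T.2
  · intro hu
    obtain ⟨x, l, r, h⟩ := IsDiword.exists_treeWord_eq u.2 hu
    exact ⟨⟨.node x l r, by simp⟩, h⟩

theorem range_dendToRB (k X : Type*) [CommRing k] :
    LinearMap.range (dendToRB k X) = diwordSpan k X := by
  have h_eq : dendToRB k X =
      Finsupp.linearCombination k fun T : NTree X => Finsupp.single (treeWord T.1 T.2) 1 := by
    ext T
    simp [dendToRB]
  rw [h_eq, Finsupp.range_linearCombination, diwordSpan, ← range_treeWord, ← Set.range_comp]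
  rfl

end Diword

theorem mainTheorem4_general {k : Type u} {V : Type v} {X : Type t} [CommRing k]
    [AddCommGroup V] [Module k V] (b : Module.Basis X k V) :
    IsFreeDendriform.{w₁} (Dend.prec k X) (Dend.succ k X) (Dend.incl b) ∧
    IsFreeRotaBaxterAlgebra.{w₂} (0 : k) (0 : V →ₗ[k] V →ₗ[k] V)
      (FreeRB.mul k X) (FreeRB.op k X) (FreeRB.incl b) ∧
    IsDendriform (FreeRB.prec k X) (FreeRB.succ k X) ∧
    IsDendriformHom (Dend.prec k X) (Dend.succ k X) (FreeRB.prec k X) (FreeRB.succ k X)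
      (dendToRB k X) ∧
    dendToRB k X ∘ₗ Dend.incl b = FreeRB.incl b ∧
    (∀ g : Dend k X →ₗ[k] FreeRB k X,
      IsDendriformHom (Dend.prec k X) (Dend.succ k X) (FreeRB.prec k X) (FreeRB.succ k X) g →
      g ∘ₗ Dend.incl b = FreeRB.incl b → g = dendToRB k X) ∧
    LinearMap.range (dendToRB k X) = diwordSpan k X ∧
    Function.Injective (dendToRB k X) := by
  have h_rb := FreeRB.isDendriform k X
  have h_hom := dendToRB_isDendriformHom k X
  have h_incl := dendToRB_comp_incl b
  refine ⟨⟨Dend.isDendriform k X, fun D _ _ precD succD hD f => Dend.existsUnique_lift b hD f⟩,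
    ⟨FreeRB.isRotaBaxterAlgebra k X, FreeRB.incl_isAlgebraHom b,
      fun A _ _ mulA RA hA f hf => FreeRB.existsUnique_lift b hA hf⟩,
    h_rb, h_hom, h_incl, fun g hg hgi => ?_, range_dendToRB k X, dendToRB_injective k X⟩
  exact (Dend.existsUnique_lift b h_rb (FreeRB.incl b)).unique ⟨hg, hgi⟩ ⟨h_hom, h_incl⟩

theorem mainTheorem4 {k : Type u} {V : Type v} {X : Type t} [Field k]
    [AddCommGroup V] [Module k V] (b : Module.Basis X k V) :
    -- the two algebras are the free ones
    IsFreeDendriform.{w₁} (Dend.prec k X) (Dend.succ k X) (Dend.incl b) ∧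
    IsFreeRotaBaxterAlgebra.{w₂} (0 : k) (0 : V →ₗ[k] V →ₗ[k] V)
      (FreeRB.mul k X) (FreeRB.op k X) (FreeRB.incl b) ∧
    -- the free Rota-Baxter algebra is a dendriform dialgebra, and `φ` is a morphism to it
    IsDendriform (FreeRB.prec k X) (FreeRB.succ k X) ∧
    IsDendriformHom (Dend.prec k X) (Dend.succ k X) (FreeRB.prec k X) (FreeRB.succ k X)
      (dendToRB k X) ∧
    -- `φ` is the unique morphism of dendriform dialgebras that extends `j_V`
    dendToRB k X ∘ₗ Dend.incl b = FreeRB.incl b ∧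
    (∀ g : Dend k X →ₗ[k] FreeRB k X,
      IsDendriformHom (Dend.prec k X) (Dend.succ k X) (FreeRB.prec k X) (FreeRB.succ k X) g →
      g ∘ₗ Dend.incl b = FreeRB.incl b → g = dendToRB k X) ∧
    -- image and injectivity
    LinearMap.range (dendToRB k X) = diwordSpan k X ∧
    Function.Injective (dendToRB k X) :=
  mainTheorem4_general b
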